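/- Conventions. For $k\le\omega$, $(\omega)^k$ is the set of partitions of $\omega=\{0,1,2,\dots\}$ into exactly $k$ nonempty blocks; a partition $p$ with blocks $B^p_0,B^p_1,\dots$, indexed so that the least elements $\mu^p(i)=\min B^p_i$ increase with $i$, is identified with the function $p:\omega\to k$ with $p^{-1}(i)=B^p_i$. For $p\in(\omega)^\omega$, $(p)^k$ is the set of all $q\in(\omega)^k$ such that every $p$-block is contained in a $q$-block. For finite $k$, $(\omega)^k_{\mathrm{fin}}$ is the set of finite strings over $\{0,\dots,k-1\}$ in which every $i<k$ occurs and the first occurrences of $0,1,\dots,k-1$ come in this order. An $\ell$-coloring of a set $S$ is a family of sets with $S=\bigcup_{i<\ell}C_i$, not necessarily disjoint. For $y\in(\omega)^\omega$ and $m<k<\omega$, a coloring $(y)^k=\bigcup_{i<\ell}C_i$ is called $m$-reduced if any $p,q\in(y)^k$ with $p\upharpoonright\mu^p(m)=q\upharpoonright\mu^q(m)$ have the same color, i.e. $p\in C_i\Leftrightarrow q\in C_i$ for all $i<\ell$; it is called reduced if it is $(k-1)$-reduced. Theorem. Let $k$ and $\ell$ be natural numbers. (1) Let $1<m<k$, let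 $y\in(\omega)^\omega$, and let $(y)^k=\bigcup_{i<\ell}C_i$ be an $m$-reduced coloring. Then there is $x\in(y)^\omega$ such that the restriction of the coloring to $(x)^k$ is $(m-1)$-reduced. (2) Let $k\ge 2$. For every $y\in(\omega)^\omega$ and every reduced coloring $(y)^k=\bigcup_{i<\ell}C_i$ there are $p\in(y)^\omega$ and $i<\ell$ such that $(p)^k\subseteq C_i$. (3) ($\mathsf{CDRT}^k_\ell$, the Combinatorial Dual Ramsey Theorem.) Let $k\ge 2$. For every coloring $(\omega)^{k-1}_{\mathrm{fin}}=\bigcup_{i<\ell}C_i$ there are $p\in(\omega)^\omega$ and $i<\ell$ such that $x\upharpoonright\mu^x(k-1)\in C_i$ for all $x\in(p)^k$. -/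

import Mathlib

namespace DualRamsey

/-- A function `f : ω → ω` is ordered if, whenever the value `i` is taken at `n`,
every `j < i` is taken at some argument below `n`. -/
def IsOrdered (f : ℕ → ℕ) : Prop :=
  ∀ n i, f n = i → ∀ j < i, ∃ m < n, f m = j

/-- A finite string is ordered if it satisfies the analogous condition. -/
def IsOrderedString (σ : List ℕ) : Prop :=
  ∀ n i : ℕ, σ[n]? = some i → ∀ j < i, ∃ m : ℕ, m < n ∧ σ[m]? = some j

/-- `(ω)^k` for `k ≤ ω` (`⊤` stands for `ω`): the `k`-partitions of `ω`, that is, the ordered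
functions on `ω` whose set of values is exactly `{i | i < k}`. The block `B_i^p` is
`p ⁻¹' {i}`. -/
def partitions (k : ℕ∞) : Set (ℕ → ℕ) :=
  {p | IsOrdered p ∧ Set.range p = {i : ℕ | (i : ℕ∞) < k}}

/-- `(ω)^k_fin` for finite `k`: the ordered strings over `k` in which all `i < k` appear. -/
def finPartitions (k : ℕ) : Set (List ℕ) :=
  {σ | IsOrderedString σ ∧ ∀ i, i ∈ σ ↔ i < k}

/-- `(p)^k`: the `k`-coarsenings of `p`. -/
def coarsenings (p : ℕ → ℕ) (k : ℕ∞) : Set (ℕ → ℕ) :=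
  {q | q ∈ partitions k ∧ ∀ n m, p n = p m → q n = q m}

/-- `μ^p(i)`: the least element of the block `B_i^p` (only used for nonempty blocks). -/
noncomputable def blockMin (p : ℕ → ℕ) (i : ℕ) : ℕ :=
  sInf {n | p n = i}

/-- `p ↾ n`: the string `p(0), …, p(n-1)`. -/
def initialString (p : ℕ → ℕ) (n : ℕ) : List ℕ :=
  (List.range n).map p

/-- The sets `C i`, `i < ℓ`, form a coloring `(y)^k = ⋃_{i < ℓ} C i`; colors may overlap. -/
def IsColoring {ℓ : ℕ} (y : ℕ → ℕ) (k : ℕ) (C : Fin ℓ → Set (ℕ → ℕ)) : Prop :=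
  coarsenings y k = ⋃ i, C i

/-- The coloring `C` of `(y)^k` is `m`-reduced: if `p, q ∈ (y)^k` satisfy
`p ↾ μ^p(m) = q ↾ μ^q(m)`, then `p` and `q` belong to the same colors. -/
def IsMReduced {ℓ : ℕ} (y : ℕ → ℕ) (k m : ℕ) (C : Fin ℓ → Set (ℕ → ℕ)) : Prop :=
  ∀ p ∈ coarsenings y k, ∀ q ∈ coarsenings y k,
    initialString p (blockMin p m) = initialString q (blockMin q m) →
      ∀ i, p ∈ C i ↔ q ∈ C i

/-- The restriction to `(x)^k` of a coloring. -/
def restrictColoring {ℓ : ℕ} (x : ℕ → ℕ) (k : ℕ) (C : Fin ℓ → Set (ℕ → ℕ)) :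
    Fin ℓ → Set (ℕ → ℕ) :=
  fun i => C i ∩ coarsenings x k

/-- The Combinatorial Dual Ramsey Theorem for `k`-partitions and `ℓ` colors: for every coloring
`(ω)^{k-1}_fin = ⋃_{i < ℓ} C i` there are `p ∈ (ω)^ω` and a color `i` such that
`x ↾ μ^x(k-1) ∈ C i` for all `x ∈ (p)^k`. -/
def CDRT (k ℓ : ℕ) : Prop :=
  ∀ C : Fin ℓ → Set (List ℕ), finPartitions (k - 1) = ⋃ i, C i →
    ∃ p ∈ partitions ⊤, ∃ i, ∀ x ∈ coarsenings p k,
      initialString x (blockMin x (k - 1)) ∈ C i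

end DualRamsey

/-!
An `m`-reduced coloring of `(y)^k` is a coloring of the strings `p ↾ μ^p(m)`, where `p` runs through
the ordered functions with `p ∘ y ∈ (y)^k`. To make the color at `p ↾ μ^p(m + 1)` depend on
`p ↾ μ^p(m)` only, fix `n = μ^p(m)`. Beyond `n`, the string `p ↾ μ^p(m + 1)` has entries at most
`m`, all of which occur at positions at most `n`, so it is a word over the alphabet `{0, …, n}` with
`p ↾ (n + 1)` applied to its letters. The Carlson–Simpson theorem yields an infinite partition on
which all these words get the same color, and a fusion over `n` serves all `n` at once. After `m`
such reductions the color depends on the empty string.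

The Carlson–Simpson theorem comes from an ultrafilter `q` on variable words with `q(a) * q = q` for
every letter `a`: choose an idempotent `q` below a minimal idempotent `e` of the ultrafilters of
constant words, inside the ideal of words containing the variable; then `q(a)` is an idempotent
below `e`, hence equal to `e`, and `e * q = q`.
-/

namespace DualRamsey

section CompactSemigroup

variable {M : Type*} [Semigroup M]

/-- An idempotent `p` which is minimal for the order on idempotents in which `e ≤ p` means
`e * p = e = p * e`. -/
def IsMinimalIdempotent (p : M) : Prop :=
  IsIdempotentElem p ∧ ∀ e, IsIdempotentElem e → e * p = e → p * e = e → e = p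

variable [TopologicalSpace M]

/-- A nonempty closed left ideal of a topological semigroup. -/
def IsClosedLeftIdeal (L : Set M) : Prop :=
  IsClosed L ∧ L.Nonempty ∧ ∀ s, ∀ l ∈ L, s * l ∈ L

variable [CompactSpace M]

theorem exists_minimal_isClosedLeftIdeal [Nonempty M] :
    ∃ L : Set M, Minimal IsClosedLeftIdeal L := by
  suffices ∃ L, L ⊆ Set.univ ∧ Minimal (· ∈ {L : Set M | IsClosedLeftIdeal L}) L from
    this.imp fun _ h => h.2
  refine zorn_superset_nonempty _ (fun c hc hchain hne => ?_) Set.univ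
    ⟨isClosed_univ, Set.univ_nonempty, fun _ _ _ => Set.mem_univ _⟩
  refine ⟨⋂₀ c, ⟨isClosed_sInter fun L hL => (hc hL).1, ?_, fun s l hl L hL => ?_⟩,
    fun L hL => Set.sInter_subset_of_mem hL⟩
  · have := hne.coe_sort
    exact IsCompact.nonempty_sInter_of_directed_nonempty_isCompact_isClosed
      (IsChain.directedOn hchain.symm) (fun L hL => (hc hL).2.1)
      (fun L hL => (hc hL).1.isCompact) fun L hL => (hc hL).1
  · exact (hc hL).2.2 s l (hl L hL)

variable [T2Space M]

theorem isMinimalIdempotent_of_mem_minimal_isClosedLeftIdeal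
    (hcont : ∀ r : M, Continuous (· * r)) {L : Set M} (hL : Minimal IsClosedLeftIdeal L) {p : M}
    (hpL : p ∈ L) (hp : IsIdempotentElem p) : IsMinimalIdempotent p := by
  refine ⟨hp, fun e he hep hpe => ?_⟩
  have heL : e ∈ L := hep ▸ hL.prop.2.2 e p hpL
  have hideal : IsClosedLeftIdeal (Set.range (· * e)) := by
    refine ⟨(isCompact_range (hcont e)).isClosed, ⟨_, e, rfl⟩, ?_⟩
    rintro s _ ⟨x, rfl⟩
    exact ⟨s * x, mul_assoc _ _ _⟩
  have hrange : Set.range (· * e) = L :=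
    hL.eq_of_subset hideal (Set.range_subset_iff.2 fun x => hL.prop.2.2 x e heL)
  obtain ⟨x, hx : x * e = p⟩ := hrange.symm ▸ hpL
  calc e = x * e * e := by rw [hx, hpe]
    _ = p := by rw [mul_assoc, he.eq, hx]

theorem exists_isMinimalIdempotent [Nonempty M] (hcont : ∀ r : M, Continuous (· * r)) :
    ∃ p : M, IsMinimalIdempotent p := by
  obtain ⟨L, hL⟩ := exists_minimal_isClosedLeftIdeal (M := M)
  obtain ⟨p, hpL, hp⟩ := exists_idempotent_in_compact_subsemigroup hcont L hL.prop.2.1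
    hL.prop.1.isCompact fun x _ y hy => hL.prop.2.2 x y hy
  exact ⟨p, isMinimalIdempotent_of_mem_minimal_isClosedLeftIdeal hcont hL hpL hp⟩

theorem exists_mem_ideal_forall_retraction_mul_eq {S ι : Type*} [Semigroup S] {p : S}
    (hp : IsMinimalIdempotent p) (hcont : ∀ r : M, Continuous (· * r)) {J : Set M}
    (hJne : J.Nonempty) (hJcl : IsClosed J) (hJl : ∀ x, ∀ j ∈ J, x * j ∈ J)
    (hJr : ∀ j ∈ J, ∀ x, j * x ∈ J) (f : S →ₙ* M) (T : ι → M →ₙ* S)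
    (hT : ∀ a, Function.LeftInverse (T a) f) :
    ∃ q ∈ J, ∀ a, f (T a q) * q = q := by
  have hfp : f p * f p = f p := by rw [← map_mul, hp.1.eq]
  obtain ⟨_, ⟨j, hj, rfl⟩, hr⟩ := exists_idempotent_in_compact_subsemigroup hcont
    ((· * f p) '' J) (hJne.image _) (hJcl.isCompact.image (hcont _)) (by
      rintro _ ⟨x, -, rfl⟩ _ ⟨y, hy, rfl⟩
      exact ⟨x * f p * y, hJl _ y hy, mul_assoc _ _ _⟩)
  set r := j * f p with hr_def
  have hrp : r * f p = r := by rw [hr_def, mul_assoc, hfp]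
  have hpq : f p * (f p * r) = f p * r := by rw [← mul_assoc, hfp]
  have hqp : f p * r * f p = f p * r := by rw [mul_assoc, hrp]
  have hqq : f p * r * (f p * r) = f p * r := by rw [← mul_assoc, hqp, mul_assoc, hr]
  refine ⟨f p * r, hJl _ _ (hJr j hj _), fun a => ?_⟩
  -- `T a` maps the idempotent `f p * r`, which lies below `f p`, to an idempotent below `p`.
  have hTq : T a (f p * r) = p := by
    refine hp.2 _ ?_ ?_ ?_
    · rw [IsIdempotentElem, ← map_mul, hqq]
    · nth_rw 2 [← hT a p]
      rw [← map_mul, hqp]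
    · nth_rw 1 [← hT a p]
      rw [← map_mul, hpq]
  rw [hTq, hpq]

end CompactSemigroup

section VariableWords

attribute [local instance] Ultrafilter.mul Ultrafilter.semigroup

/-- The homomorphism between the semigroups of ultrafilters that extends a homomorphism of
semigroups. -/
def ultrafilterMap {M N : Type*} [Mul M] [Mul N] (f : M →ₙ* N) :
    Ultrafilter M →ₙ* Ultrafilter N where
  toFun U := U.map f
  map_mul' U V := Ultrafilter.coe_inj.mp <| Filter.ext' fun P => by
    simp only [Ultrafilter.coe_map, Filter.eventually_map, Ultrafilter.eventually_mul, map_mul]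

variable {A : Type*}

/-- The constant words over `A` as variable words; the variable is `none`. -/
def constWord : FreeMonoid A →ₙ* FreeMonoid (Option A) := (FreeMonoid.map some).toMulHom

/-- The substitution of the letter `a` for the variable `none`. -/
def substVar (a : A) : FreeMonoid (Option A) →ₙ* FreeMonoid A :=
  (FreeMonoid.map (Option.getD · a)).toMulHom

theorem exists_variableWord_ultrafilter (A : Type*) :
    ∃ q : Ultrafilter (FreeMonoid (Option A)),
      (∀ᶠ w in (q : Filter (FreeMonoid (Option A))), none ∈ FreeMonoid.toList w) ∧
      ∀ a : A, ultrafilterMap constWord (ultrafilterMap (substVar a) q) * q = q := by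
  obtain ⟨p, hp⟩ := exists_isMinimalIdempotent (M := Ultrafilter (FreeMonoid A))
    Ultrafilter.continuous_mul_left
  refine exists_mem_ideal_forall_retraction_mul_eq
    (J := {U : Ultrafilter (FreeMonoid (Option A)) | {w | none ∈ FreeMonoid.toList w} ∈ U})
    hp Ultrafilter.continuous_mul_left ⟨pure (FreeMonoid.of none), ?_⟩
    (ultrafilter_isClosed_basic _) (fun U V hV => ?_) (fun V hV U => ?_)
    (ultrafilterMap constWord) (fun a => ultrafilterMap (substVar a)) fun a U => ?_
  · exact Ultrafilter.mem_pure.2 (List.mem_singleton_self _)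
  · refine (Ultrafilter.eventually_mul U V _).2 (.of_forall fun v => ?_)
    exact Filter.mem_of_superset hV fun w hw => List.mem_append_right _ hw
  · refine (Ultrafilter.eventually_mul V U _).2 ?_
    filter_upwards [hV] with v hv
    exact .of_forall fun w => List.mem_append_left _ hv
  · have hcomp : substVar a ∘ constWord = id :=
      funext fun w => (List.map_map ..).trans (List.map_id _)
    change (U.map constWord).map (substVar a) = U
    rw [Ultrafilter.map_map, hcomp, Ultrafilter.map_id]

/-- The part of a variable word before the first occurrence of the variable. -/
def constPart : List (Option A) → List A
  | [] => []
  | none :: _ => []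
  | some a :: l => a :: constPart l

theorem constPart_map_some_append (s : List A) (l : List (Option A)) :
    constPart (s.map some ++ l) = s ++ constPart l := by
  induction s with
  | nil => rfl
  | cons a s ih => simp only [List.map_cons, List.cons_append, constPart, ih]

theorem exists_eq_constPart_append {w : List (Option A)} (h : none ∈ w) :
    ∃ r, w = (constPart w).map some ++ none :: r := by
  induction w with
  | nil => exact absurd h List.not_mem_nil
  | cons o w ih =>
    cases o with
    | none => exact ⟨w, rfl⟩
    | some a =>
      obtain ⟨r, hr⟩ := ih (by simpa using h)
      exact ⟨r, congrArg (some a :: ·) hr⟩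

/-- The ultrafilters `q` of variable words (with variable `none`) that satisfy `q(a) * q = q` for
every letter `a`, where `q(a)` is the image of `q` under substitution of `a`. Only the part of a
word before its first variable is ever tested, and so the equation is stated for it alone. -/
def IsSubstitutionInvariant (q : Ultrafilter (List (Option A))) : Prop :=
  (∀ᶠ w in (q : Filter (List (Option A))), none ∈ w) ∧
  ∀ D : List A → Prop, (∀ᶠ u in (q : Filter (List (Option A))), D (constPart u)) → ∀ a,
    ∀ᶠ w in (q : Filter (List (Option A))), ∀ᶠ u in (q : Filter (List (Option A))),
      D (w.map (Option.getD · a) ++ constPart u)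

theorem exists_isSubstitutionInvariant (A : Type*) :
    ∃ q : Ultrafilter (List (Option A)), IsSubstitutionInvariant q := by
  obtain ⟨q, hvar, hq⟩ := exists_variableWord_ultrafilter A
  refine ⟨q, hvar, fun D hD a => ?_⟩
  change ∀ᶠ u in (q : Filter (FreeMonoid (Option A))), D (constPart u.toList) at hD
  rw [← hq a, Ultrafilter.eventually_mul] at hD
  refine Filter.Eventually.mono (f := (q : Filter (FreeMonoid (Option A)))) hD fun w hw => ?_
  refine Filter.Eventually.mono hw fun u hu => ?_
  exact constPart_map_some_append (w.toList.map (Option.getD · a)) u ▸ hu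

end VariableWords

section Partitions

variable {k : ℕ∞} {i j n : ℕ} {p q x : ℕ → ℕ}

theorem mem_partitions_top : p ∈ partitions ⊤ ↔ IsOrdered p ∧ Function.Surjective p := by
  simp only [partitions, Set.mem_ofPred_eq, ENat.natCast_lt_top, Set.ofPred_true,
    Set.range_eq_univ]

theorem mem_partitions_natCast {k : ℕ} :
    p ∈ partitions k ↔ IsOrdered p ∧ ∀ i, i ∈ Set.range p ↔ i < k := by
  simp only [partitions, Set.mem_ofPred_eq, Set.ext_iff, Nat.cast_lt]

theorem mem_range_of_mem_partitions {k : ℕ} (hp : p ∈ partitions k) (hi : i < k) :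
    i ∈ Set.range p :=
  ((mem_partitions_natCast.1 hp).2 i).2 hi

theorem mem_range_comp_iff (hx : x ∈ partitions ⊤) : i ∈ Set.range (p ∘ x) ↔ i ∈ Set.range p := by
  rw [(mem_partitions_top.1 hx).2.range_comp]

theorem id_mem_partitions_top : id ∈ partitions ⊤ :=
  mem_partitions_top.2 ⟨fun _ _ hi j hj => ⟨j, hj.trans_eq hi.symm, rfl⟩, Function.surjective_id⟩

theorem nonempty_partitions {k : ℕ} (hk : 0 < k) : (partitions k).Nonempty := by
  obtain ⟨k, rfl⟩ := Nat.exists_eq_succ_of_ne_zero hk.ne'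
  refine ⟨fun i => min i k,
    mem_partitions_natCast.2 ⟨fun n i hi j hj => ⟨j, ?_⟩, fun i => ⟨?_, fun hi => ⟨i, ?_⟩⟩⟩⟩
  · dsimp only at hi ⊢
    omega
  · rintro ⟨n, rfl⟩
    exact Nat.lt_succ_iff.2 (min_le_right n k)
  · exact min_eq_left (Nat.lt_succ_iff.1 hi)

theorem IsOrdered.apply_le (hp : IsOrdered p) (n : ℕ) : p n ≤ n := by
  suffices ∀ i, p n = i → i ≤ n from this _ rfl
  induction n using Nat.strong_induction_on with
  | _ n ih =>
    rintro (_ | i) hi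
    · exact n.zero_le
    · obtain ⟨m, hmn, hm⟩ := hp n _ hi i i.lt_succ_self
      exact (ih m hmn i hm).trans_lt hmn

theorem IsOrdered.mem_range_of_lt (hp : IsOrdered p) (hj : j ∈ Set.range p) (hij : i < j) :
    i ∈ Set.range p := by
  obtain ⟨n, rfl⟩ := hj
  obtain ⟨m, -, hm⟩ := hp n _ rfl i hij
  exact ⟨m, hm⟩

theorem IsOrdered.comp (hp : IsOrdered p) (hx : IsOrdered x) : IsOrdered (p ∘ x) := by
  intro n i hi j hj
  obtain ⟨_, hm, rfl⟩ := hp (x n) i hi j hj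
  obtain ⟨m, hmn, rfl⟩ := hx n _ rfl _ hm
  exact ⟨m, hmn, rfl⟩

theorem comp_mem_partitions (hp : p ∈ partitions k) (hx : x ∈ partitions ⊤) :
    p ∘ x ∈ partitions k := by
  obtain ⟨hxo, hxs⟩ := mem_partitions_top.1 hx
  exact ⟨hp.1.comp hxo, by rw [hxs.range_comp]; exact hp.2⟩

theorem comp_mem_coarsenings (hp : p ∈ partitions k) (hx : x ∈ partitions ⊤) :
    p ∘ x ∈ coarsenings x k :=
  ⟨comp_mem_partitions hp hx, fun _ _ h => congrArg p h⟩

theorem apply_blockMin (hi : i ∈ Set.range p) : p (blockMin p i) = i :=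
  Nat.sInf_mem (s := {n | p n = i}) hi

theorem apply_ne_of_lt_blockMin (hn : n < blockMin p i) : p n ≠ i :=
  Nat.notMem_of_lt_sInf (s := {n | p n = i}) hn

theorem blockMin_le (hn : p n = i) : blockMin p i ≤ n :=
  Nat.sInf_le (s := {n | p n = i}) hn

theorem blockMin_eq (hn : p n = i) (hlt : ∀ m < n, p m ≠ i) : blockMin p i = n :=
  (blockMin_le hn).antisymm <| not_lt.1 fun h => hlt _ h (apply_blockMin ⟨n, hn⟩)

theorem IsOrdered.apply_lt_of_lt_blockMin (hp : IsOrdered p) (hn : n < blockMin p i) :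
    p n < i := by
  refine (apply_ne_of_lt_blockMin hn).lt_of_le (not_lt.1 fun h => ?_)
  obtain ⟨m, hmn, hm⟩ := hp n _ rfl i h
  exact apply_ne_of_lt_blockMin (hmn.trans hn) hm

theorem IsOrdered.blockMin_lt_blockMin (hp : IsOrdered p) (hj : j ∈ Set.range p) (hij : i < j) :
    blockMin p i < blockMin p j := by
  obtain ⟨m, hm, hmi⟩ := hp _ j (apply_blockMin hj) i hij
  exact (blockMin_le hmi).trans_lt hm

theorem blockMin_comp (hx : x ∈ partitions ⊤) (hi : i ∈ Set.range p) :
    blockMin (p ∘ x) i = blockMin x (blockMin p i) := by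
  obtain ⟨hxo, hxs⟩ := mem_partitions_top.1 hx
  refine blockMin_eq ?_ fun m hm => ?_
  · rw [Function.comp_apply, apply_blockMin (hxs _), apply_blockMin hi]
  · exact apply_ne_of_lt_blockMin (p := p) (hxo.apply_lt_of_lt_blockMin hm)

theorem blockMin_eq_self (h : ∀ i ≤ n, p i = i) : blockMin p n = n :=
  blockMin_eq (h n le_rfl) fun m hm => by rw [h m hm.le]; exact hm.ne

theorem exists_eq_comp_of_mem_coarsenings (hx : x ∈ partitions ⊤) (hq : q ∈ coarsenings x k) :
    ∃ p ∈ partitions k, q = p ∘ x := by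
  obtain ⟨hxo, hxs⟩ := mem_partitions_top.1 hx
  have hcomp : q = (fun i => q (blockMin x i)) ∘ x :=
    funext fun n => hq.2 _ _ (apply_blockMin ⟨n, rfl⟩).symm
  refine ⟨_, ⟨fun n i hi j hj => ?_, ?_⟩, hcomp⟩
  · obtain ⟨m, hm, hmj⟩ := hq.1.1 _ i hi j hj
    exact ⟨x m, hxo.apply_lt_of_lt_blockMin hm, (congrFun hcomp m).symm.trans hmj⟩
  · rw [← hxs.range_comp, ← hcomp]
    exact hq.1.2

end Partitions

section BlockPrefix

variable {i j n N : ℕ} {p q x : ℕ → ℕ}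

/-- The string `p ↾ μ^p(i)` on which the colors of the theorem depend. -/
noncomputable def blockPrefix (p : ℕ → ℕ) (i : ℕ) : List ℕ :=
  initialString p (blockMin p i)

theorem length_blockPrefix (p : ℕ → ℕ) (i : ℕ) : (blockPrefix p i).length = blockMin p i := by
  simp only [blockPrefix, initialString, List.length_map, List.length_range]

theorem getElem?_initialString_eq_some :
    (initialString p N)[n]? = some i ↔ n < N ∧ p n = i := by
  by_cases hn : n < N <;> simp [initialString, hn]

theorem getD_blockPrefix (hn : n < blockMin p i) (d : ℕ) : (blockPrefix p i).getD n d = p n := by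
  rw [List.getD_eq_getElem?_getD, blockPrefix, getElem?_initialString_eq_some.2 ⟨hn, rfl⟩,
    Option.getD_some]

theorem IsOrdered.isOrderedString_initialString (hp : IsOrdered p) (N : ℕ) :
    IsOrderedString (initialString p N) := by
  intro n i hi j hj
  obtain ⟨hn, hni⟩ := getElem?_initialString_eq_some.1 hi
  obtain ⟨m, hmn, hm⟩ := hp n i hni j hj
  exact ⟨m, hmn, getElem?_initialString_eq_some.2 ⟨hmn.trans hn, hm⟩⟩

theorem isOrdered_of_isOrderedString_initialString
    (h : ∀ n, ∃ N > n, IsOrderedString (initialString p N)) : IsOrdered p := by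
  intro n i hi j hj
  obtain ⟨N, hN, hord⟩ := h n
  obtain ⟨m, hmn, hm⟩ := hord n i (getElem?_initialString_eq_some.2 ⟨hN, hi⟩) j hj
  exact ⟨m, hmn, (getElem?_initialString_eq_some.1 hm).2⟩

theorem IsOrdered.lt_of_mem_blockPrefix (hp : IsOrdered p) (hj : j ∈ blockPrefix p i) :
    j < i := by
  obtain ⟨n, hn, rfl⟩ := List.mem_map.1 hj
  exact hp.apply_lt_of_lt_blockMin (List.mem_range.1 hn)

theorem IsOrdered.blockPrefix_mem_finPartitions (hp : IsOrdered p) (hi : i ∈ Set.range p) :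
    blockPrefix p i ∈ finPartitions i := by
  refine ⟨hp.isOrderedString_initialString _, fun j => ⟨hp.lt_of_mem_blockPrefix, fun hj => ?_⟩⟩
  obtain ⟨n, hn, rfl⟩ := hp _ i (apply_blockMin hi) j hj
  exact List.mem_map_of_mem (List.mem_range.2 hn)

theorem blockPrefix_eq_initialString (hN : ∀ a ∈ initialString p N, a < i) (hpN : p N = i) :
    blockPrefix p i = initialString p N := by
  have hmin : blockMin p i = N := blockMin_eq hpN fun m hm =>
    (hN _ (List.mem_map_of_mem (List.mem_range.2 hm))).ne
  rw [blockPrefix, hmin]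

theorem blockPrefix_zero (hp : IsOrdered p) : blockPrefix p 0 = [] :=
  blockPrefix_eq_initialString (N := 0) (fun _ h => absurd h List.not_mem_nil)
    (Nat.le_zero.1 (hp.apply_le 0))

theorem blockPrefix_eq_blockPrefix_iff : blockPrefix p i = blockPrefix q i ↔
    blockMin p i = blockMin q i ∧ ∀ n < blockMin p i, p n = q n := by
  constructor
  · intro h
    have hmin : blockMin p i = blockMin q i := by
      rw [← length_blockPrefix, h, length_blockPrefix]
    rw [blockPrefix, blockPrefix, ← hmin] at h
    exact ⟨hmin, fun n hn => List.map_inj_left.1 h n (List.mem_range.2 hn)⟩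
  · rintro ⟨hmin, h⟩
    rw [blockPrefix, blockPrefix, ← hmin]
    exact List.map_congr_left fun n hn => h n (List.mem_range.1 hn)

theorem blockPrefix_comp (hx : x ∈ partitions ⊤) (hi : i ∈ Set.range p) :
    blockPrefix (p ∘ x) i = (blockPrefix x (blockMin p i)).map p := by
  rw [blockPrefix, blockMin_comp hx hi, blockPrefix, initialString, initialString, List.map_map]

theorem exists_blockPrefix_comp_eq (hx : x ∈ partitions ⊤) :
    ∃ f : List ℕ → List ℕ, ∀ p i, i ∈ Set.range p →
      blockPrefix (p ∘ x) i = f (blockPrefix p i) := by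
  refine ⟨fun σ => (blockPrefix x σ.length).map (σ.getD · 0), fun p i hi => ?_⟩
  dsimp only
  rw [blockPrefix_comp hx hi, length_blockPrefix]
  exact List.map_congr_left fun n hn => (getD_blockPrefix (hx.1.lt_of_mem_blockPrefix hn) 0).symm

theorem blockPrefix_comp_inj (hx : x ∈ partitions ⊤) (hp : i ∈ Set.range p)
    (hq : i ∈ Set.range q) (h : blockPrefix (p ∘ x) i = blockPrefix (q ∘ x) i) :
    blockPrefix p i = blockPrefix q i := by
  obtain ⟨hxo, hxs⟩ := mem_partitions_top.1 hx
  rw [blockPrefix_eq_blockPrefix_iff, blockMin_comp hx hp, blockMin_comp hx hq] at h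
  refine blockPrefix_eq_blockPrefix_iff.2 ⟨?_, fun n hn => ?_⟩
  · rw [← apply_blockMin (hxs (blockMin p i)), h.1, apply_blockMin (hxs _)]
  · simpa only [Function.comp_apply, apply_blockMin (hxs n)] using
      h.2 _ (hxo.blockMin_lt_blockMin (hxs _) hn)

theorem isOrderedString_append {σ τ : List ℕ} (hσ : IsOrderedString σ)
    (hτ : ∀ a ∈ τ, ∀ j < a, j ∈ σ) : IsOrderedString (σ ++ τ) := by
  intro n i hi j hj
  rw [List.getElem?_append] at hi
  split_ifs at hi with hn
  · obtain ⟨m, hmn, hm⟩ := hσ n i hi j hj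
    exact ⟨m, hmn, by rw [List.getElem?_append_left (hmn.trans hn), hm]⟩
  · obtain ⟨m, hm, hmj⟩ := List.getElem_of_mem (hτ i (List.mem_of_getElem? hi) j hj)
    exact ⟨m, by omega, by rw [List.getElem?_append_left hm, List.getElem?_eq_getElem hm, hmj]⟩

theorem append_mem_finPartitions {σ τ : List ℕ} {k : ℕ} (hσ : σ ∈ finPartitions k)
    (hτ : ∀ a ∈ τ, a < k) : σ ++ τ ∈ finPartitions k := by
  refine ⟨isOrderedString_append hσ.1 fun a ha j hj => (hσ.2 j).2 (hj.trans (hτ a ha)),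
    fun i => ?_⟩
  rw [List.mem_append, ← hσ.2]
  exact or_iff_left_of_imp fun hi => (hσ.2 i).2 (hτ i hi)

theorem concat_mem_finPartitions {σ : List ℕ} {k : ℕ} (hσ : σ ∈ finPartitions k) :
    σ ++ [k] ∈ finPartitions (k + 1) := by
  refine ⟨isOrderedString_append hσ.1 fun a ha j hj => (hσ.2 j).2 ?_, fun i => ?_⟩
  · rwa [← List.mem_singleton.1 ha]
  · rw [List.mem_append, List.mem_singleton, hσ.2, Nat.lt_succ_iff_lt_or_eq]

theorem range_mem_finPartitions (n : ℕ) : List.range n ∈ finPartitions n := by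
  have hid := id_mem_partitions_top.1.blockPrefix_mem_finPartitions (p := id) (i := n) ⟨n, rfl⟩
  rwa [blockPrefix, blockMin_eq_self (p := id) fun _ _ => rfl, initialString, List.map_id] at hid

theorem exists_limit_of_isPrefix {L : ℕ → List ℕ} (hL : ∀ j, L j <+: L (j + 1))
    (hlen : ∀ j, j ≤ (L j).length) : ∃ g : ℕ → ℕ, ∀ j l, l <+: L j →
      l = initialString g l.length := by
  have hmono : ∀ i j, i ≤ j → L i <+: L j := fun i j hij => by
    induction j, hij using Nat.le_induction with
    | base => exact List.prefix_rfl
    | succ j _ ih => exact ih.trans (hL j)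
  refine ⟨fun i => (L (i + 1)).getD i 0, fun j l hl => List.ext_getElem ?_ fun i hi _ => ?_⟩
  · rw [initialString, List.length_map, List.length_range]
  have hi' : i < (L (i + 1)).length := hlen (i + 1)
  simp only [initialString, List.getElem_map, List.getElem_range, List.getD_eq_getElem _ _ hi']
  rcases le_total j (i + 1) with h | h
  · exact (hl.trans (hmono _ _ h)).getElem hi
  · rw [hl.getElem hi, (hmono _ _ h).getElem hi']

theorem exists_partition_blockPrefix_eq {n : ℕ} {M : ℕ → List ℕ}
    (hM : ∀ j, M j ∈ finPartitions (n + j)) (hpre : ∀ j, M j ++ [n + j] <+: M (j + 1)) :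
    ∃ g ∈ partitions ⊤, ∀ j, blockPrefix g (n + j) = M j := by
  have hlen : ∀ j, j ≤ (M j).length := fun j => by
    induction j with
    | zero => exact Nat.zero_le _
    | succ j ih =>
      have := (hpre j).length_le
      rw [List.length_append, List.length_singleton] at this
      omega
  obtain ⟨g, hg⟩ := exists_limit_of_isPrefix (fun j => (List.prefix_append _ _).trans (hpre j)) hlen
  have hgM : ∀ j, initialString g (M j).length = M j := fun j =>
    (hg j _ List.prefix_rfl).symm
  have hgvar : ∀ j, g (M j).length = n + j := fun j => by
    have hget : (M j ++ [n + j])[(M j).length]? = some (n + j) := by simp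
    rw [hg (j + 1) _ (hpre j)] at hget
    exact (getElem?_initialString_eq_some.1 hget).2
  have hord : IsOrdered g := isOrdered_of_isOrderedString_initialString fun t =>
    ⟨(M (t + 1)).length, hlen _, by rw [hgM]; exact (hM (t + 1)).1⟩
  have hsurj : Function.Surjective g := fun i =>
    hord.mem_range_of_lt ⟨_, hgvar (i + 1)⟩ (by omega)
  refine ⟨g, mem_partitions_top.2 ⟨hord, hsurj⟩, fun j => ?_⟩
  rw [blockPrefix_eq_initialString (fun a ha => ?_) (hgvar j), hgM]
  rw [hgM] at ha
  exact ((hM j).2 a).1 ha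

end BlockPrefix

section CarlsonSimpson

theorem IsSubstitutionInvariant.exists_variableWord {A : Type*} [Finite A]
    {q : Ultrafilter (List (Option A))} (hq : IsSubstitutionInvariant q) {D : List A → Prop}
    {R : Set (List A)} (hR : R.Finite)
    (h : ∀ l ∈ R, ∀ᶠ u in (q : Filter (List (Option A))), D (l ++ constPart u)) :
    ∃ w : List (Option A), none ∈ w ∧ ∀ l ∈ R, D (l ++ constPart w) ∧ ∀ a,
      ∀ᶠ u in (q : Filter (List (Option A))),
        D (l ++ w.map (Option.getD · a) ++ constPart u) := by
  simp only [List.append_assoc]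
  exact (hq.1.and <| (Filter.eventually_all_finite hR).2 fun l hl => (h l hl).and <|
    Filter.eventually_all.2 (hq.2 (fun s => D (l ++ s)) (h l hl))).exists

variable {n k : ℕ} {q : Ultrafilter (List (Option (Fin n)))} {D : List (Fin n) → Prop}

/-- The variable word `w` as a string of numbers, with the number `k` for the variable. -/
def natWord (k : ℕ) (w : List (Option (Fin n))) : List ℕ :=
  w.map fun o => o.elim k Fin.val

theorem map_natWord {r : ℕ → Fin n} (hr : Function.LeftInverse r Fin.val) (k : ℕ)
    (w : List (Option (Fin n))) : (natWord k w).map r = w.map (Option.getD · (r k)) := by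
  rw [natWord, List.map_map]
  refine List.map_congr_left fun o _ => ?_
  cases o with
  | none => rfl
  | some a => exact hr a

theorem append_constPart_mem_finPartitions (hnk : n ≤ k) {L : List ℕ} (hL : L ∈ finPartitions k)
    (w : List (Option (Fin n))) : L ++ (constPart w).map Fin.val ∈ finPartitions k :=
  append_mem_finPartitions hL fun _ hi => by
    obtain ⟨a, -, rfl⟩ := List.mem_map.1 hi
    exact a.2.trans_le hnk

theorem constPart_append_isPrefix_natWord {w : List (Option (Fin n))} (hw : none ∈ w) (k : ℕ) :
    (constPart w).map Fin.val ++ [k] <+: natWord k w := by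
  obtain ⟨s, hs⟩ := exists_eq_constPart_append hw
  refine ⟨natWord k s, ?_⟩
  conv_rhs => rw [hs]
  simp only [natWord, List.map_append, List.map_map, List.map_cons, List.append_assoc,
    List.singleton_append]
  rfl

theorem append_natWord_mem_finPartitions (hnk : n ≤ k) {L : List ℕ} (hL : L ∈ finPartitions k)
    {w : List (Option (Fin n))} (hw : none ∈ w) : L ++ natWord k w ∈ finPartitions (k + 1) := by
  obtain ⟨t, ht⟩ := constPart_append_isPrefix_natWord hw k
  have hlt : ∀ i ∈ natWord k w, i < k + 1 := fun i hi => by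
    obtain ⟨_ | a, -, rfl⟩ := List.mem_map.1 hi
    · exact k.lt_succ_self
    · exact (a.2.trans_le hnk).trans k.lt_succ_self
  rw [← ht, ← List.append_assoc, ← List.append_assoc]
  exact append_mem_finPartitions
    (concat_mem_finPartitions (append_constPart_mem_finPartitions hnk hL w)) fun i hi =>
      hlt i (ht ▸ List.mem_append_right _ hi)

/-- The invariant of the Carlson–Simpson construction for a string `L` whose entries `i ≥ n` are
read as variables: every substitution instance of `L`, extended by the constant part of almost
every variable word, has the property `D`. -/
def IsPromising (q : Ultrafilter (List (Option (Fin n)))) (D : List (Fin n) → Prop)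
    (L : List ℕ) : Prop :=
  ∀ r : ℕ → Fin n, Function.LeftInverse r Fin.val →
    ∀ᶠ u in (q : Filter (List (Option (Fin n)))), D (L.map r ++ constPart u)

theorem isPromising_range (hD : ∀ᶠ u in (q : Filter (List (Option (Fin n)))),
    D (List.finRange n ++ constPart u)) : IsPromising q D (List.range n) := by
  intro r hr
  have hmap : (List.range n).map r = List.finRange n := by
    rw [← List.map_coe_finRange_eq_range, List.map_map, hr.comp_eq_id, List.map_id]
  rwa [hmap]

theorem IsPromising.exists_extension (hq : IsSubstitutionInvariant q) (hnk : n ≤ k) {L : List ℕ}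
    (hL : L ∈ finPartitions k) (hD : IsPromising q D L) :
    ∃ M L', M ∈ finPartitions k ∧ L' ∈ finPartitions (k + 1) ∧ L <+: M ∧ M ++ [k] <+: L' ∧
      IsPromising q D L' ∧
      ∀ r : ℕ → Fin n, Function.LeftInverse r Fin.val → D (M.map r) := by
  have hfin : {l | ∃ r : ℕ → Fin n, Function.LeftInverse r Fin.val ∧ L.map r = l}.Finite :=
    (List.finite_length_eq (Fin n) L.length).subset <| by
      rintro _ ⟨r, -, rfl⟩
      exact List.length_map r
  obtain ⟨w, hvar, hw⟩ := hq.exists_variableWord (D := D) hfin <| by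
    rintro _ ⟨r, hr, rfl⟩
    exact hD r hr
  refine ⟨L ++ (constPart w).map Fin.val, L ++ natWord k w,
    append_constPart_mem_finPartitions hnk hL w, append_natWord_mem_finPartitions hnk hL hvar,
    List.prefix_append _ _, ?_, fun r hr => ?_, fun r hr => ?_⟩
  · rw [List.append_assoc, List.prefix_append_right_inj]
    exact constPart_append_isPrefix_natWord hvar k
  · rw [List.map_append, map_natWord hr]
    exact (hw _ ⟨r, hr, rfl⟩).2 (r k)
  · rw [List.map_append, List.map_map, hr.comp_eq_id, List.map_id]
    exact (hw _ ⟨r, hr, rfl⟩).1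

theorem exists_partition_forall_substitution (hq : IsSubstitutionInvariant q)
    (hD : ∀ᶠ u in (q : Filter (List (Option (Fin n)))), D (List.finRange n ++ constPart u)) :
    ∃ g ∈ partitions ⊤, (∀ i < n, g i = i) ∧ ∀ j ≥ n, ∀ r : ℕ → Fin n,
      Function.LeftInverse r Fin.val → D ((blockPrefix g j).map r) := by
  choose! F G hF hG hLF hFG hGD hFD using fun j (L : List ℕ)
    (h : L ∈ finPartitions (n + j) ∧ IsPromising q D L) =>
      h.2.exists_extension hq (n.le_add_right j) h.1
  let L : ℕ → List ℕ := Nat.rec (List.range n) G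
  have hL : ∀ j, L j ∈ finPartitions (n + j) ∧ IsPromising q D (L j) := fun j => by
    induction j with
    | zero => exact ⟨range_mem_finPartitions n, isPromising_range hD⟩
    | succ j ih => exact ⟨hG j _ ih, hGD j _ ih⟩
  obtain ⟨g, hg, hgF⟩ := exists_partition_blockPrefix_eq (fun j => hF j _ (hL j)) fun j =>
    (hFG j _ (hL j)).trans (hLF (j + 1) _ (hL (j + 1)))
  refine ⟨g, hg, fun i hi => ?_, fun j hj r hr => ?_⟩
  · have hpre : List.range n <+: blockPrefix g n := hgF 0 ▸ hLF 0 _ (hL 0)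
    have hi' : i < (List.range n).length := by rwa [List.length_range]
    have hget : (blockPrefix g n)[i]? = some i := by
      rw [List.prefix_iff_getElem?.1 hpre i hi', List.getElem_range]
    exact (getElem?_initialString_eq_some.1 hget).2
  · obtain ⟨j, rfl⟩ := Nat.exists_eq_add_of_le hj
    rw [hgF j]
    exact hFD j _ (hL j) r hr

theorem carlson_simpson {K : Type*} [Finite K] (n : ℕ) (c : List (Fin n) → K) :
    ∃ g ∈ partitions ⊤, (∀ i < n, g i = i) ∧ ∃ κ, ∀ j ≥ n, ∀ r : ℕ → Fin n,
      Function.LeftInverse r Fin.val → c ((blockPrefix g j).map r) = κ := by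
  obtain ⟨q, hq⟩ := exists_isSubstitutionInvariant (Fin n)
  obtain ⟨κ, hκ⟩ := (q.eventually_exists_iff
    (P := fun κ u => c (List.finRange n ++ constPart u) = κ)).1 (.of_forall fun _ => ⟨_, rfl⟩)
  obtain ⟨g, hg, hgn, hgκ⟩ := exists_partition_forall_substitution (D := (c · = κ)) hq hκ
  exact ⟨g, hg, hgn, κ, hgκ⟩

end CarlsonSimpson

section Fusion

/-- A sequence of infinite partitions, each of which coarsens the previous one, where the passage
from `X n` to `X (n + 1)` keeps the blocks with index at most `n` apart from each other. -/
def IsFusionSequence (X : ℕ → ℕ → ℕ) : Prop :=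
  (∀ n, X n ∈ partitions ⊤) ∧ ∀ n, ∃ g : ℕ → ℕ, (∀ i ≤ n, g i = i) ∧ X (n + 1) = g ∘ X n

variable {X : ℕ → ℕ → ℕ} {n N s t : ℕ}

theorem IsFusionSequence.apply_eq_of_apply_le (hX : IsFusionSequence X) (hs : X n s ≤ n)
    (hN : n ≤ N) : X N s = X n s := by
  induction N, hN using Nat.le_induction with
  | base => rfl
  | succ N hN ih =>
    obtain ⟨g, hg, hXg⟩ := hX.2 N
    rw [hXg, Function.comp_apply, ih, hg _ (hs.trans hN)]

theorem IsFusionSequence.apply_eq_diagonal (hX : IsFusionSequence X) (hN : t ≤ N) :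
    X N t = X t t :=
  hX.apply_eq_of_apply_le ((hX.1 t).1.apply_le t) hN

theorem IsFusionSequence.diagonal_eq_of_apply_le (hX : IsFusionSequence X) (hs : X n s ≤ n) :
    X s s = X n s := by
  rw [← hX.apply_eq_diagonal (le_max_right n s), hX.apply_eq_of_apply_le hs (le_max_left n s)]

theorem IsFusionSequence.apply_eq_apply_of_le (hX : IsFusionSequence X) (h : X n s = X n t)
    (hN : n ≤ N) : X N s = X N t := by
  induction N, hN using Nat.le_induction with
  | base => exact h
  | succ N _ ih =>
    obtain ⟨g, -, hXg⟩ := hX.2 N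
    rw [hXg, Function.comp_apply, Function.comp_apply, ih]

theorem IsFusionSequence.diagonal_mem_partitions (hX : IsFusionSequence X) :
    (fun t => X t t) ∈ partitions ⊤ := by
  refine mem_partitions_top.2 ⟨fun n i hi j hj => ?_, fun i => ?_⟩
  · obtain ⟨s, hs, hXs⟩ := (hX.1 n).1 n i hi j hj
    exact ⟨s, hs, (hX.apply_eq_diagonal hs.le).symm.trans hXs⟩
  · obtain ⟨t, ht⟩ := (mem_partitions_top.1 (hX.1 i)).2 i
    exact ⟨t, (hX.diagonal_eq_of_apply_le ht.le).trans ht⟩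

theorem IsFusionSequence.diagonal_mem_coarsenings (hX : IsFusionSequence X) (n : ℕ) :
    (fun t => X t t) ∈ coarsenings (X n) ⊤ := by
  refine ⟨hX.diagonal_mem_partitions, fun s t hst => ?_⟩
  have hXN := hX.apply_eq_apply_of_le hst (le_max_left n (max s t))
  rwa [hX.apply_eq_diagonal (le_max_of_le_right (le_max_left s t)),
    hX.apply_eq_diagonal (le_max_of_le_right (le_max_right s t))] at hXN

theorem IsFusionSequence.exists_diagonal_eq_comp (hX : IsFusionSequence X) (n : ℕ) :
    ∃ h ∈ partitions ⊤, (∀ i ≤ n, h i = i) ∧ (fun t => X t t) = h ∘ X n := by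
  obtain ⟨h, hh, hXh⟩ := exists_eq_comp_of_mem_coarsenings (hX.1 n) (hX.diagonal_mem_coarsenings n)
  refine ⟨h, hh, fun i hi => ?_, hXh⟩
  obtain ⟨s, rfl⟩ := (mem_partitions_top.1 (hX.1 n)).2 i
  exact (congrFun hXh s).symm.trans (hX.diagonal_eq_of_apply_le hi)

theorem exists_fusion {P : ℕ → (ℕ → ℕ) → Prop} (hP : ∀ n, ∀ x ∈ partitions ⊤,
      ∃ g ∈ partitions ⊤, (∀ i ≤ n, g i = i) ∧ P n (g ∘ x)) :
    ∃ x ∈ partitions ⊤, ∀ n, ∃ z, P n z ∧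
      ∃ h ∈ partitions ⊤, (∀ i ≤ n, h i = i) ∧ x = h ∘ z := by
  choose! g hg hgfix hgP using hP
  let X : ℕ → ℕ → ℕ := Nat.rec id fun n x => g n x ∘ x
  have hXtop : ∀ n, X n ∈ partitions ⊤ := fun n => by
    induction n with
    | zero => exact id_mem_partitions_top
    | succ n ih => exact comp_mem_partitions (hg n _ ih) ih
  have hX : IsFusionSequence X := ⟨hXtop, fun n => ⟨_, hgfix n _ (hXtop n), rfl⟩⟩
  refine ⟨_, hX.diagonal_mem_partitions, fun n => ⟨X (n + 1), hgP n _ (hXtop n), ?_⟩⟩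
  obtain ⟨h, hh, hfix, hXh⟩ := hX.exists_diagonal_eq_comp (n + 1)
  exact ⟨h, hh, fun i hi => hfix i (hi.trans n.le_succ), hXh⟩

end Fusion

section StringColoring

variable {K : Type*} {m n : ℕ} {p : ℕ → ℕ}

theorem IsOrdered.exists_retraction (hp : IsOrdered p) (hm : m ∈ Set.range p) :
    ∃ r : ℕ → Fin (blockMin p m + 1), Function.LeftInverse r Fin.val ∧
      ∀ i < blockMin p (m + 1), p (r i) = p i := by
  refine ⟨fun i => if h : i < blockMin p m + 1 then ⟨i, h⟩ else
    Fin.ofNat _ (blockMin p (p i)), fun a => dif_pos a.2, fun i hi => ?_⟩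
  dsimp only
  split_ifs with h
  · rfl
  have hle : blockMin p (p i) ≤ blockMin p m := by
    rcases (Nat.lt_succ_iff.1 (hp.apply_lt_of_lt_blockMin hi)).eq_or_lt with heq | hlt
    · rw [heq]
    · exact (hp.blockMin_lt_blockMin hm hlt).le
  rw [Fin.val_ofNat, Nat.mod_eq_of_lt (Nat.lt_succ_of_le hle), apply_blockMin (p := p) ⟨i, rfl⟩]

/-- On the coarsenings `p ∘ x` with `μ^p(m) = n`, the coloring `d` of the strings
`(p ∘ x) ↾ μ(m + 1)` depends on the string `p ↾ μ^p(m)` only. -/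
def IsReducedAt (d : List ℕ → K) (m n : ℕ) (x : ℕ → ℕ) : Prop :=
  ∃ e : List ℕ → K, ∀ p, IsOrdered p → m + 1 ∈ Set.range p → blockMin p m = n →
    d (blockPrefix (p ∘ x) (m + 1)) = e (blockPrefix p m)

theorem exists_isReducedAt [Finite K] (d : List ℕ → K) (m n : ℕ) :
    ∃ g ∈ partitions ⊤, (∀ i ≤ n, g i = i) ∧ IsReducedAt d m n g := by
  -- Coloring `τ` by the function `σ ↦ d (σ ∘ τ)` treats all beginnings `σ` at the same time.
  obtain ⟨g, hg, hgfix, κ, hκ⟩ := carlson_simpson (n + 1)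
    fun τ (σ : Fin (n + 1) → Fin (m + 1)) => d (τ.map fun a => (σ a).val)
  -- The value `m` of `p` at `n` itself is not an entry of `blockPrefix p m`.
  refine ⟨g, hg, fun i hi => hgfix i (Nat.lt_succ_of_le hi),
    fun l => κ fun a => Fin.ofNat (m + 1) (l.getD a m), ?_⟩
  rintro p hp hmp rfl
  have hm := hp.mem_range_of_lt hmp m.lt_succ_self
  obtain ⟨r, hr, hpr⟩ := hp.exists_retraction hm
  have hσ : ∀ a : Fin (blockMin p m + 1),
      (Fin.ofNat (m + 1) ((blockPrefix p m).getD a m)).val = p a.val := fun a => by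
    rcases (Nat.lt_succ_iff.1 a.2).eq_or_lt with ha | ha
    · rw [List.getD_eq_default _ _ (by rw [length_blockPrefix, ha]), ha, apply_blockMin hm,
        Fin.val_ofNat, Nat.mod_eq_of_lt m.lt_succ_self]
    · rw [getD_blockPrefix ha, Fin.val_ofNat,
        Nat.mod_eq_of_lt ((hp.apply_lt_of_lt_blockMin ha).trans m.lt_succ_self)]
  have hblock : blockPrefix (p ∘ g) (m + 1) =
      ((blockPrefix g (blockMin p (m + 1))).map r).map (p ∘ Fin.val) := by
    rw [blockPrefix_comp hg hmp, List.map_map]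
    exact List.map_congr_left fun i hi => (hpr i (hg.1.lt_of_mem_blockPrefix hi)).symm
  rw [hblock, ← hκ _ (hp.blockMin_lt_blockMin hmp m.lt_succ_self) r hr]
  simp only [hσ, Function.comp_def]

theorem exists_isReducedAt_comp [Finite K] {x : ℕ → ℕ} (hx : x ∈ partitions ⊤) (d : List ℕ → K)
    (m n : ℕ) : ∃ g ∈ partitions ⊤, (∀ i ≤ n, g i = i) ∧ IsReducedAt d m n (g ∘ x) := by
  obtain ⟨f, hf⟩ := exists_blockPrefix_comp_eq hx
  obtain ⟨g, hg, hgfix, e, he⟩ := exists_isReducedAt (d ∘ f) m n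
  refine ⟨g, hg, hgfix, e, fun p hp hmp hpn => ?_⟩
  rw [← he p hp hmp hpn, Function.comp_apply, ← hf _ _ ((mem_range_comp_iff hg).2 hmp),
    Function.comp_assoc]

theorem IsReducedAt.comp {d : List ℕ → K} {h x : ℕ → ℕ} (hd : IsReducedAt d m n x)
    (hh : h ∈ partitions ⊤) (hfix : ∀ i ≤ n, h i = i) : IsReducedAt d m n (h ∘ x) := by
  obtain ⟨e, he⟩ := hd
  refine ⟨e, ?_⟩
  rintro p hp hmp rfl
  have hm := hp.mem_range_of_lt hmp m.lt_succ_self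
  have hmin : blockMin (p ∘ h) m = blockMin p m := by
    rw [blockMin_comp hh hm, blockMin_eq_self hfix]
  have hblock : blockPrefix (p ∘ h) m = blockPrefix p m :=
    blockPrefix_eq_blockPrefix_iff.2
      ⟨hmin, fun i hi => congrArg p (hfix i (hi.le.trans hmin.le))⟩
  rw [← hblock, ← he _ (hp.comp hh.1) ((mem_range_comp_iff hh).2 hmp) hmin, Function.comp_assoc]

theorem exists_reduce_stringColoring [Finite K] (d : List ℕ → K) (m : ℕ) :
    ∃ x ∈ partitions ⊤, ∃ e : List ℕ → K, ∀ p, IsOrdered p → m + 1 ∈ Set.range p →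
      d (blockPrefix (p ∘ x) (m + 1)) = e (blockPrefix p m) := by
  obtain ⟨x, hx, hfusion⟩ := exists_fusion fun n x hx => exists_isReducedAt_comp hx d m n
  have hred : ∀ n, IsReducedAt d m n x := fun n => by
    obtain ⟨z, hz, h, hh, hfix, rfl⟩ := hfusion n
    exact hz.comp hh hfix
  choose e he using hred
  refine ⟨x, hx, fun l => e l.length l, fun p hp hmp => ?_⟩
  dsimp only
  rw [he _ p hp hmp rfl, length_blockPrefix]

theorem exists_homogeneous_stringColoring [Finite K] (d : List ℕ → K) (m : ℕ) :
    ∃ x ∈ partitions ⊤, ∃ κ, ∀ p, IsOrdered p → m ∈ Set.range p →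
      d (blockPrefix (p ∘ x) m) = κ := by
  induction m generalizing d with
  | zero =>
    refine ⟨id, id_mem_partitions_top, d [], fun p hp _ => ?_⟩
    rw [Function.comp_id, blockPrefix_zero hp]
  | succ m ih =>
    obtain ⟨x, hx, e, he⟩ := exists_reduce_stringColoring d m
    obtain ⟨x', hx', κ, hκ⟩ := ih e
    refine ⟨x' ∘ x, comp_mem_partitions hx' hx, κ, fun p hp hmp => ?_⟩
    rw [← Function.comp_assoc, he _ (hp.comp hx'.1) ((mem_range_comp_iff hx').2 hmp)]
    exact hκ p hp (hp.mem_range_of_lt hmp m.lt_succ_self)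

end StringColoring

section ReducedColorings

variable {ℓ k m : ℕ} {y : ℕ → ℕ} {C : Fin ℓ → Set (ℕ → ℕ)}

theorem IsMReduced.exists_stringColoring (hm : m < k) (hy : y ∈ partitions ⊤)
    (hC : IsMReduced y k m C) :
    ∃ d : List ℕ → Set (Fin ℓ), ∀ p ∈ partitions k, d (blockPrefix p m) = {i | p ∘ y ∈ C i} := by
  obtain ⟨f, hf⟩ := exists_blockPrefix_comp_eq hy
  refine ⟨fun l => {i | ∃ p ∈ partitions k, blockPrefix p m = l ∧ p ∘ y ∈ C i}, fun p hp =>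
    Set.ext fun i => ⟨?_, fun h => ⟨p, hp, rfl, h⟩⟩⟩
  rintro ⟨q, hq, hqp, hqC⟩
  refine (hC _ (comp_mem_coarsenings hp hy) _ (comp_mem_coarsenings hq hy) ?_ i).2 hqC
  change blockPrefix (p ∘ y) m = blockPrefix (q ∘ y) m
  rw [hf p m (mem_range_of_mem_partitions hp hm), hf q m (mem_range_of_mem_partitions hq hm), hqp]

theorem IsMReduced.exists_isMReduced (hm : m + 1 < k) (hy : y ∈ partitions ⊤)
    (hC : IsMReduced y k (m + 1) C) :
    ∃ x ∈ coarsenings y ⊤, IsMReduced x k m (restrictColoring x k C) := by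
  obtain ⟨d, hd⟩ := hC.exists_stringColoring hm hy
  obtain ⟨x, hx, e, he⟩ := exists_reduce_stringColoring d m
  have hxy := comp_mem_partitions hx hy
  have hcolor : ∀ p ∈ partitions k, {i | p ∘ x ∘ y ∈ C i} = e (blockPrefix p m) := fun p hp => by
    rw [← he p hp.1 (mem_range_of_mem_partitions hp hm), hd _ (comp_mem_partitions hp hx),
      Function.comp_assoc]
  refine ⟨x ∘ y, comp_mem_coarsenings hx hy, fun p hp q hq h i =>
    and_congr ?_ (iff_of_true hp hq)⟩
  obtain ⟨p, hpk, rfl⟩ := exists_eq_comp_of_mem_coarsenings hxy hp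
  obtain ⟨q, hqk, rfl⟩ := exists_eq_comp_of_mem_coarsenings hxy hq
  have hmk := m.lt_succ_self.trans hm
  have hpq : blockPrefix p m = blockPrefix q m := blockPrefix_comp_inj hxy
    (mem_range_of_mem_partitions hpk hmk) (mem_range_of_mem_partitions hqk hmk) h
  exact Set.ext_iff.1 ((hcolor p hpk).trans ((congrArg e hpq).trans (hcolor q hqk).symm)) i

theorem IsMReduced.exists_homogeneous (hm : m < k) (hy : y ∈ partitions ⊤)
    (hcol : IsColoring y k C) (hC : IsMReduced y k m C) :
    ∃ x ∈ coarsenings y ⊤, ∃ i, coarsenings x k ⊆ C i := by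
  obtain ⟨d, hd⟩ := hC.exists_stringColoring hm hy
  obtain ⟨x, hx, κ, hκ⟩ := exists_homogeneous_stringColoring d m
  have hcolor : ∀ p ∈ partitions k, {i | p ∘ x ∘ y ∈ C i} = κ := fun p hp => by
    rw [← hκ p hp.1 (mem_range_of_mem_partitions hp hm), hd _ (comp_mem_partitions hp hx),
      Function.comp_assoc]
  obtain ⟨r, hr⟩ := nonempty_partitions (m.zero_le.trans_lt hm)
  have hry : r ∘ x ∘ y ∈ ⋃ i, C i :=
    hcol.subset (comp_mem_coarsenings (comp_mem_partitions hr hx) hy)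
  obtain ⟨i, hi⟩ := Set.mem_iUnion.1 hry
  refine ⟨x ∘ y, comp_mem_coarsenings hx hy, i, fun q hq => ?_⟩
  obtain ⟨p, hp, rfl⟩ := exists_eq_comp_of_mem_coarsenings (comp_mem_partitions hx hy) hq
  exact Set.ext_iff.1 ((hcolor r hr).trans (hcolor p hp).symm) i |>.1 hi

theorem cdrt_succ (k ℓ : ℕ) : CDRT (k + 1) ℓ := by
  intro C hC
  obtain ⟨x, hx, κ, hκ⟩ := exists_homogeneous_stringColoring (fun l => {i | l ∈ C i}) k
  have hxk : blockPrefix x k ∈ ⋃ i, C i := hC.subset <|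
    hx.1.blockPrefix_mem_finPartitions ((mem_partitions_top.1 hx).2 k)
  obtain ⟨i, hi⟩ := Set.mem_iUnion.1 hxk
  have hiκ : i ∈ κ := hκ id id_mem_partitions_top.1 ⟨k, rfl⟩ ▸ hi
  refine ⟨x, hx, i, fun q hq => ?_⟩
  obtain ⟨p, hp, rfl⟩ := exists_eq_comp_of_mem_coarsenings hx hq
  exact (hκ p hp.1 (mem_range_of_mem_partitions hp k.lt_succ_self)).superset hiκ

end ReducedColorings

end DualRamsey

theorem mainTheorem8 :
    -- every `m`-reduced coloring of `(y)^k` is `(m-1)`-reduced on some `(x)^k`, `x ∈ (y)^ω`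
    (∀ k m ℓ : ℕ, 1 < m → m < k →
      ∀ y ∈ DualRamsey.partitions ⊤, ∀ C : Fin ℓ → Set (ℕ → ℕ),
        DualRamsey.IsColoring y k C → DualRamsey.IsMReduced y k m C →
          ∃ x ∈ DualRamsey.coarsenings y ⊤,
            DualRamsey.IsMReduced x k (m - 1) (DualRamsey.restrictColoring x k C)) ∧
    -- every reduced coloring of `(y)^k` has a homogeneous `p ∈ (y)^ω`
    (∀ k ℓ : ℕ, 2 ≤ k →
      ∀ y ∈ DualRamsey.partitions ⊤, ∀ C : Fin ℓ → Set (ℕ → ℕ),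
        DualRamsey.IsColoring y k C → DualRamsey.IsMReduced y k (k - 1) C →
          ∃ p ∈ DualRamsey.coarsenings y ⊤, ∃ i, DualRamsey.coarsenings p k ⊆ C i) ∧
    -- the Combinatorial Dual Ramsey Theorem
    (∀ k ℓ : ℕ, 2 ≤ k → DualRamsey.CDRT k ℓ) := by
  refine ⟨fun k m ℓ hm hmk y hy C _ hC => ?_, fun k ℓ hk y hy C hcol hC => ?_, fun k ℓ hk => ?_⟩
  · obtain ⟨m, rfl⟩ := Nat.exists_eq_succ_of_ne_zero (Nat.zero_lt_of_lt hm).ne'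
    exact hC.exists_isMReduced hmk hy
  · exact hC.exists_homogeneous (Nat.sub_lt (Nat.zero_lt_of_lt hk) Nat.one_pos) hy hcol
  · obtain ⟨k, rfl⟩ := Nat.exists_eq_succ_of_ne_zero (Nat.zero_lt_of_lt hk).ne'
    exact DualRamsey.cdrt_succ k ℓ
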